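/- Let $2\omega_1\in\mathbb R\setminus\{0\}$ and $2\omega_3\in i\mathbb R\setminus\{0\}$, let $\Lambda=2\omega_1\mathbb Z+2\omega_3\mathbb Z$, and let $$\sigma(u)=u\prod_{s\in\Lambda\setminus\{0\}}\Bigl(1-\frac us\Bigr)\exp\Bigl(\frac us+\frac{u^2}{2s^2}\Bigr)$$ be the Weierstrass sigma function; put $\zeta=\sigma'/\sigma$ and $\eta_1=\zeta(\omega_1)$. Let $w\in\mathbb R$ satisfy $wN_1\ne\omega_1N_2$ for all integers $N_1,N_2$ that are not both zero, and write $[x]=\sigma(wx)/\sigma(w)$, $[x]_k=[x][x+1]\cdots[x+k-1]$ and $${}_{r+1}E_r\left({a_1,\dots,a_{r+1}\atop b_1,\dots,b_r};z\right)=\sum_{s=0}^\infty\frac{[a_1]_s\cdots[a_{r+1}]_s}{[1]_s[b_1]_s\cdots[b_r]_s}\,e^{Ms(s-1)}z^s,\qquad M=\frac{\eta_1}{2\omega_1}w^2\Bigl(1+\sum_{i=1}^r b_i-\sum_{i=1}^{r+1}a_i\Bigr).$$ Let $\alpha,\beta,\gamma\in\mathbb C$ with $\beta\notin\Lambda$ and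 $wk+\alpha\notin\Lambda$ for every $k\in\mathbb Z$, put $\hat\alpha=\alpha/w$, $\hat\beta=\beta/w$, and define the moments $$c_k=e^{\gamma wk+\gamma\alpha}\,\frac{\sigma(wk+\beta+\alpha)}{\sigma(wk+\alpha)\,\sigma(\beta)},\qquad k\in\mathbb Z.$$ Let $n\ge0$ and $\Delta_n=\det(c_{j-i})_{0\le i,j\le n-1}$ (with $\Delta_0=1$). Assume that $\Delta_n\neq0$ and that $[-(\hat\alpha+1)n-\hat\beta]_n\ne0$, so that no denominator below vanishes. Let $P_n(z)$ be $\Delta_n^{-1}$ times the $(n+1)\times(n+1)$ determinant whose rows are $(c_{-i},c_{1-i},\dots,c_{n-i})$ for $i=0,\dots,n-1$, followed by the last row $(1,z,\dots,z^n)$. Then $P_n$ is a monic polynomial of degree $n$, and for all $z\in\mathbb C$ $$P_n(z)=B_n\;{}_3E_2\left({-n,\ \hat\alpha+1,\ -(\hat\alpha+1)n-\hat\beta+1\atop \hat\alpha+1-n,\ -(\hat\alpha+1)n-\hat\beta};\,ze^{-\gamma w}\right),$$ where the series terminates (the terms with $s>n$ are zero) and $$B_n=e^{\gamma wn}\,\frac{[-\hat\alpha]_n}{[\hat\alpha+1]_n}\,\frac{[\hat\alpha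 n+\hat\beta+n]}{[\hat\alpha n+\hat\beta]}.$$ -/

import Mathlib

open Polynomial

noncomputable section

namespace EllipticLBP

/-- The Weierstrass sigma function of the lattice spanned over `ℤ` by the periods of `L`:
`σ(u) = u ∏' (1 - u/s) exp(u/s + u²/(2s²))`, the product being over the nonzero lattice points. -/
def sigma (L : PeriodPair) (u : ℂ) : ℂ :=
  u * ∏' s : {s : ℂ // s ∈ L.lattice ∧ s ≠ 0},
    (1 - u / (s : ℂ)) * Complex.exp (u / (s : ℂ) + u ^ 2 / (2 * (s : ℂ) ^ 2))

/-- The Weierstrass zeta function `ζ = σ'/σ`. -/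
def zeta (L : PeriodPair) (u : ℂ) : ℂ := deriv (sigma L) u / sigma L u

/-- `η₁ = ζ(ω₁)`, where `2ω₁ = L.ω₁` is the first period. -/
def eta₁ (L : PeriodPair) : ℂ := zeta L (L.ω₁ / 2)

/-- The elliptic number `[x] = σ(wx)/σ(w)`. -/
def ellNum (L : PeriodPair) (w x : ℂ) : ℂ := sigma L (w * x) / sigma L w

/-- The elliptic Pochhammer symbol `[x]_k = [x][x+1]⋯[x+k-1]`. -/
def ellPoch (L : PeriodPair) (w x : ℂ) (k : ℕ) : ℂ :=
  ∏ i ∈ Finset.range k, ellNum L w (x + i)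

/-- The constant `M = η₁ w² (1 + ∑ bᵢ - ∑ aᵢ) / (2ω₁)`, with `2ω₁ = L.ω₁`. -/
def ellM (L : PeriodPair) (w : ℂ) {r : ℕ} (a : Fin (r + 1) → ℂ) (b : Fin r → ℂ) : ℂ :=
  eta₁ L / L.ω₁ * w ^ 2 * (1 + ∑ i, b i - ∑ i, a i)

/-- The `s`-th term of the elliptic hypergeometric series. -/
def ellHypTerm (L : PeriodPair) (w : ℂ) {r : ℕ} (a : Fin (r + 1) → ℂ) (b : Fin r → ℂ)
    (z : ℂ) (s : ℕ) : ℂ :=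
  (∏ i, ellPoch L w (a i) s) / (ellPoch L w 1 s * ∏ i, ellPoch L w (b i) s) *
    Complex.exp (ellM L w a b * (s : ℂ) * ((s : ℂ) - 1)) * z ^ s

/-- The elliptic hypergeometric function `_{r+1}E_r(a; b; z)`. -/
def ellHyp (L : PeriodPair) (w : ℂ) {r : ℕ} (a : Fin (r + 1) → ℂ) (b : Fin r → ℂ)
    (z : ℂ) : ℂ :=
  ∑' s : ℕ, ellHypTerm L w a b z s

/-- The Toeplitz determinant `Δ_n = det (c_{j-i})`, `0 ≤ i, j ≤ n-1`. -/
def toeplitzDet (c : ℤ → ℂ) (n : ℕ) : ℂ :=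
  (Matrix.of fun i j : Fin n => c ((j : ℤ) - (i : ℤ))).det

/-- The Laurent biorthogonal polynomial `P_n` of the moments `c`: `Δ_n⁻¹` times the determinant
with rows `(c_{-i}, c_{1-i}, …, c_{n-i})`, `0 ≤ i ≤ n-1`, and last row `(1, z, …, zⁿ)`. -/
def lbp (c : ℤ → ℂ) (n : ℕ) : ℂ[X] :=
  C (toeplitzDet c n)⁻¹ *
    (Matrix.of fun i j : Fin (n + 1) =>
      if (i : ℕ) < n then C (c ((j : ℤ) - (i : ℤ))) else X ^ (j : ℕ)).det

/-- The moments `c_k = e^{γwk+γα} σ(wk+β+α) / (σ(wk+α) σ(β))`. -/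
def moment (L : PeriodPair) (w α β γ : ℂ) (k : ℤ) : ℂ :=
  Complex.exp (γ * w * k + γ * α) *
    (sigma L (w * k + β + α) / (sigma L (w * k + α) * sigma L β))

/-- The coefficient
`B_n = e^{γwn} ([-α̂]_n / [α̂+1]_n) ([α̂n+β̂+n] / [α̂n+β̂])`, `α̂ = α/w`, `β̂ = β/w`. -/
def coeffB (L : PeriodPair) (w α β γ : ℂ) (n : ℕ) : ℂ :=
  Complex.exp (γ * w * n) * (ellPoch L w (-(α / w)) n / ellPoch L w (α / w + 1) n) *
    (ellNum L w (α / w * n + β / w + n) / ellNum L w (α / w * n + β / w))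

/-- Upper parameters `(-n, α̂+1, -(α̂+1)n-β̂+1)`. -/
def upperParams (w α β : ℂ) (n : ℕ) : Fin 3 → ℂ :=
  ![-(n : ℂ), α / w + 1, -(α / w + 1) * n - β / w + 1]

/-- Lower parameters `(α̂+1-n, -(α̂+1)n-β̂)`. -/
def lowerParams (w α β : ℂ) (n : ℕ) : Fin 2 → ℂ :=
  ![α / w + 1 - n, -(α / w + 1) * n - β / w]

end EllipticLBP

end

/-! Expanding the determinant shows that, up to a scalar, `P_n` is the polynomial `∑ q_j z^j` with
`∑_j q_j c_{j-i} = 0` for `0 ≤ i < n`. So it suffices to exhibit such coefficients `q_s`; they are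
`lbpCoeff`. Multiplying `q_s` by `c_{s-i}` cancels the denominator `σ(w(s-i)+α)`, and the
exponential no longer depends on `s`. What remains is a constant times `∏_b σ(ws-b) / ∏_{j≠s}
σ(ws-wj)`, with `n+1` points `b` whose sum equals that of the nodes `0, w, …, nw`. Orthogonality is
thus an instance of elliptic partial fractions (`sum_sigmaFracTerm`); the nodes are distinct modulo
the lattice by the condition on `w`.

Partial fractions follow by induction from the three-term identity `sigma_three_term`, itself a case
of Liouville's theorem. Its input is quasi-periodicity (`sigma_add_lattice`), obtained by
integrating twice the periodicity of `℘ = -ζ'`.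

Finally, `q_{s+1}/q_s` is the term ratio of the `₃E₂` series at `e^{-γw}`, and `q_0/q_n = B_n`. The
parameters are balanced, so `M = 0`. -/

noncomputable section

namespace EllipticLBP

open Filter Topology Set

/-! ### The sigma product: convergence, parity, zeros. -/

/-- The factor `(1 - u/l) exp(u/l + u²/(2l²))` of the sigma function (equal to `1` for `l = 0`). -/
def sigmaFactor (l u : ℂ) : ℂ := (1 - u / l) * Complex.exp (u / l + u ^ 2 / (2 * l ^ 2))

lemma sigmaFactor_zero_left (u : ℂ) : sigmaFactor 0 u = 1 := by simp [sigmaFactor]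

lemma sigmaFactor_zero_right (l : ℂ) : sigmaFactor l 0 = 1 := by simp [sigmaFactor]

lemma sigmaFactor_neg_neg (l u : ℂ) : sigmaFactor (-l) (-u) = sigmaFactor l u := by
  simp [sigmaFactor]

lemma sigmaFactor_ne_zero {l u : ℂ} (h : l = 0 ∨ u ≠ l) : sigmaFactor l u ≠ 0 := by
  rcases eq_or_ne l 0 with rfl | hl
  · simp [sigmaFactor_zero_left]
  refine mul_ne_zero (fun h0 ↦ ?_) (Complex.exp_ne_zero _)
  rw [sub_eq_zero, eq_comm, div_eq_one_iff_eq hl] at h0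
  tauto

lemma differentiable_sigmaFactor (l : ℂ) : Differentiable ℂ (sigmaFactor l) := by
  unfold sigmaFactor
  simp only [div_eq_mul_inv]
  fun_prop

/-- The derivative is `-v² exp(v + v²/2)`, so the mean value inequality gives cubic order. Order 3
exceeds the rank 2 of the lattice, which makes the product converge. -/
lemma norm_one_sub_mul_exp_sub_one_le {v : ℂ} (hv : ‖v‖ ≤ 1) :
    ‖(1 - v) * Complex.exp (v + v ^ 2 / 2) - 1‖ ≤ Real.exp 2 * ‖v‖ ^ 3 := by
  have hd : ∀ x ∈ Metric.closedBall (0 : ℂ) ‖v‖,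
      HasDerivWithinAt (fun v : ℂ ↦ (1 - v) * Complex.exp (v + v ^ 2 / 2))
        (-x ^ 2 * Complex.exp (x + x ^ 2 / 2)) (Metric.closedBall (0 : ℂ) ‖v‖) x := by
    intro x _
    have h1 : HasDerivAt (fun v : ℂ ↦ v + v ^ 2 / 2) (1 + x) x := by
      have := (hasDerivAt_id x).add ((hasDerivAt_pow 2 x).div_const 2)
      convert! this using 1
      simp
    have h2 := ((hasDerivAt_id x).const_sub 1).mul h1.cexp
    refine HasDerivAt.hasDerivWithinAt ?_
    convert! h2 using 1
    simp only [id]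
    ring
  have hb : ∀ x ∈ Metric.closedBall (0 : ℂ) ‖v‖,
      ‖-x ^ 2 * Complex.exp (x + x ^ 2 / 2)‖ ≤ Real.exp 2 * ‖v‖ ^ 2 := by
    intro x hx
    have hx' : ‖x‖ ≤ ‖v‖ := by simpa using hx
    -- In fact the norm is at most `3/2`; this is the origin of the constant `exp 2`.
    have h1 : ‖x + x ^ 2 / 2‖ ≤ 2 := by
      refine (norm_add_le _ _).trans ?_
      rw [norm_div, norm_pow]
      simp only [Complex.norm_ofNat]
      nlinarith [norm_nonneg x]
    rw [norm_mul, norm_neg, norm_pow, mul_comm]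
    gcongr
    exact (Complex.norm_exp_le_exp_norm _).trans (Real.exp_le_exp.mpr h1)
  have := (convex_closedBall (0 : ℂ) ‖v‖).norm_image_sub_le_of_norm_hasDerivWithin_le hd hb
    (x := 0) (y := v) (by simp) (by simp)
  simp only [sub_zero, zero_pow two_ne_zero, zero_div, add_zero, Complex.exp_zero, mul_one] at this
  exact this.trans_eq (by ring)

lemma norm_sigmaFactor_sub_one_le {l u : ℂ} (h : ‖u‖ ≤ ‖l‖) :
    ‖sigmaFactor l u - 1‖ ≤ Real.exp 2 * ‖u‖ ^ 3 * ‖l‖ ^ (-3 : ℝ) := by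
  rcases eq_or_ne l 0 with rfl | hl
  · simp only [sigmaFactor_zero_left, sub_self, norm_zero]
    positivity
  have hl' : 0 < ‖l‖ := norm_pos_iff.mpr hl
  have := norm_one_sub_mul_exp_sub_one_le (v := u / l) (by rw [norm_div]; exact div_le_one_of_le₀ h hl'.le)
  have e : sigmaFactor l u = (1 - u / l) * Complex.exp (u / l + (u / l) ^ 2 / 2) := by
    rw [sigmaFactor]; congr 3; ring
  rw [e]
  refine this.trans_eq ?_
  have : ‖l‖ ^ (-3 : ℝ) = (‖l‖ ^ 3)⁻¹ := by
    rw [Real.rpow_neg hl'.le]; norm_cast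
  rw [this, norm_div, div_pow, mul_assoc, div_eq_mul_inv]

variable (L : PeriodPair)

lemma summable_norm_rpow_neg_three : Summable fun l : L.lattice ↦ ‖(l : ℂ)‖ ^ (-3 : ℝ) :=
  ZLattice.summable_norm_rpow _ _ (by simp; norm_num)

lemma eventually_le_norm (r : ℝ) : ∀ᶠ l : L.lattice in cofinite, r ≤ ‖(l : ℂ)‖ := by
  refine (isCompact_iff_finite.mp (isCompact_closedBall (0 : L.lattice) r)).subset ?_
  intro l hl
  simp only [mem_compl_iff, mem_ofPred_eq, not_le] at hl
  simpa using hl.le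

lemma hasProdLocallyUniformlyOn_sigmaFactor (r : ℝ) :
    HasProdLocallyUniformlyOn (fun (l : L.lattice) u ↦ sigmaFactor l u)
      (fun u ↦ ∏' l : L.lattice, sigmaFactor l u) (Metric.ball 0 r) := by
  have := Summable.hasProdLocallyUniformlyOn_one_add (f := fun (l : L.lattice) u ↦ sigmaFactor l u - 1)
    (K := Metric.ball (0 : ℂ) r) Metric.isOpen_ball
    ((summable_norm_rpow_neg_three L).mul_left (Real.exp 2 * r ^ 3)) ?_ ?_
  · simpa using this
  · filter_upwards [eventually_le_norm L r] with l hl u hu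
    have hu : ‖u‖ < r := by simpa using hu
    refine (norm_sigmaFactor_sub_one_le (hu.le.trans hl)).trans ?_
    gcongr
  · exact fun l ↦ ((differentiable_sigmaFactor l).continuous.sub continuous_const).continuousOn

lemma summable_norm_sigmaFactor_sub_one (u : ℂ) :
    Summable fun l : L.lattice ↦ ‖sigmaFactor l u - 1‖ := by
  refine Summable.of_norm_bounded_eventually
    ((summable_norm_rpow_neg_three L).mul_left (Real.exp 2 * ‖u‖ ^ 3)) ?_
  filter_upwards [eventually_le_norm L ‖u‖] with l hl
  simpa using norm_sigmaFactor_sub_one_le hl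

/-- The product of the factors of the sigma function, i.e. `σ(u)/u`. -/
def sigmaProd (u : ℂ) : ℂ := ∏' l : L.lattice, sigmaFactor l u

lemma differentiable_sigmaProd : Differentiable ℂ (sigmaProd L) := by
  intro u
  have h := (hasProdLocallyUniformlyOn_sigmaFactor L (‖u‖ + 1))
  rw [hasProdLocallyUniformlyOn_iff_tendstoLocallyUniformlyOn] at h
  refine (h.differentiableOn (.of_forall fun s ↦ ?_) Metric.isOpen_ball).differentiableAt
    (Metric.isOpen_ball.mem_nhds (by simp))
  exact (Differentiable.fun_finsetProd fun (i : L.lattice) _ ↦ differentiable_sigmaFactor i).differentiableOn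

lemma sigma_eq_mul_sigmaProd (u : ℂ) : sigma L u = u * sigmaProd L u := by
  rw [sigma, sigmaProd]
  congr 1
  let g : {s : ℂ // s ∈ L.lattice ∧ s ≠ 0} → L.lattice := fun s ↦ ⟨s.1, s.2.1⟩
  have hg : Function.Injective g := fun a b h ↦ Subtype.ext congr(($h).1)
  -- The point `l = 0` contributes the factor `1`, since division by zero is zero, so the product
  -- may run over the whole lattice.
  refine hg.tprod_eq (f := fun l : L.lattice ↦ sigmaFactor l u) fun l hl ↦ ?_
  refine ⟨⟨l.1, l.2, fun h ↦ hl ?_⟩, rfl⟩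
  simp [h, sigmaFactor_zero_left]

lemma sigmaProd_zero : sigmaProd L 0 = 1 := by simp [sigmaProd, sigmaFactor_zero_right]

lemma sigmaProd_ne_zero {u : ℂ} (h : u = 0 ∨ u ∉ L.lattice) : sigmaProd L u ≠ 0 := by
  have := tprod_one_add_ne_zero_of_summable (f := fun l : L.lattice ↦ sigmaFactor l u - 1) ?_
    (summable_norm_sigmaFactor_sub_one L u)
  · simpa [sigmaProd] using this
  · intro l
    rw [add_sub_cancel]
    refine sigmaFactor_ne_zero ?_
    rcases h with rfl | h
    · exact (eq_or_ne l.1 0).imp_right Ne.symm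
    · exact .inr fun h' ↦ h (h' ▸ l.2)

lemma sigmaProd_neg (u : ℂ) : sigmaProd L (-u) = sigmaProd L u := by
  simp only [sigmaProd]
  rw [← (Equiv.neg L.lattice).tprod_eq]
  simp [sigmaFactor_neg_neg]

lemma sigma_neg (u : ℂ) : sigma L (-u) = -sigma L u := by
  simp [sigma_eq_mul_sigmaProd, sigmaProd_neg]

lemma differentiable_sigma : Differentiable ℂ (sigma L) := by
  have : sigma L = fun u ↦ u * sigmaProd L u := funext (sigma_eq_mul_sigmaProd L)
  rw [this]
  exact differentiable_id.mul (differentiable_sigmaProd L)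

lemma continuous_sigma : Continuous (sigma L) := (differentiable_sigma L).continuous

lemma sigma_zero : sigma L 0 = 0 := by simp [sigma]

lemma sigma_ne_zero {u : ℂ} (h : u ∉ L.lattice) : sigma L u ≠ 0 := by
  rw [sigma_eq_mul_sigmaProd]
  exact mul_ne_zero (fun h0 ↦ h (h0 ▸ zero_mem _)) (sigmaProd_ne_zero L (.inr h))

lemma deriv_sigma_zero : deriv (sigma L) 0 = 1 := by
  have : sigma L = fun u ↦ u * sigmaProd L u := funext (sigma_eq_mul_sigmaProd L)
  rw [this, deriv_fun_mul differentiableAt_fun_id (differentiable_sigmaProd L 0)]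
  simp [sigmaProd_zero]

/-! ### The logarithmic derivative of sigma and its relation to `℘`. -/

lemma logDeriv_sigmaFactor {l u : ℂ} (hu : u ≠ l) :
    logDeriv (sigmaFactor l) u = u ^ 2 / (l ^ 2 * (u - l)) := by
  rcases eq_or_ne l 0 with rfl | hl
  · have : sigmaFactor 0 = fun _ ↦ 1 := funext sigmaFactor_zero_left
    simp [this, logDeriv_apply]
  have h1 : HasDerivAt (fun u : ℂ ↦ 1 - u / l) (-(1 / l)) u :=
    ((hasDerivAt_id u).div_const l).const_sub 1
  have h2 : HasDerivAt (fun u : ℂ ↦ u / l + u ^ 2 / (2 * l ^ 2)) (1 / l + u / l ^ 2) u := by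
    have := ((hasDerivAt_id u).div_const l).add ((hasDerivAt_pow 2 u).div_const (2 * l ^ 2))
    convert! this using 1
    field_simp
    push_cast; ring
  have h3 := h1.mul h2.cexp
  have h4 : deriv (sigmaFactor l) u = _ := h3.deriv
  have h5 : l - u ≠ 0 := sub_ne_zero.mpr hu.symm
  have h6 : u - l ≠ 0 := sub_ne_zero.mpr hu
  rw [logDeriv_apply, h4, sigmaFactor]
  have h7 : (1 - u / l) ≠ 0 := by
    rw [one_sub_div hl]; exact div_ne_zero h5 hl
  set e := Complex.exp (u / l + u ^ 2 / (2 * l ^ 2)) with he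
  have h8 : e ≠ 0 := Complex.exp_ne_zero _
  rw [div_eq_div_iff (mul_ne_zero h7 h8) (mul_ne_zero (pow_ne_zero 2 hl) h6)]
  field_simp
  ring

lemma summable_logDeriv_sigmaFactor (u : ℂ) :
    Summable fun l : L.lattice ↦ u ^ 2 / ((l : ℂ) ^ 2 * (u - l)) := by
  refine Summable.of_norm_bounded_eventually
    ((summable_norm_rpow_neg_three L).mul_left (2 * ‖u‖ ^ 2)) ?_
  filter_upwards [eventually_le_norm L (2 * ‖u‖ + 1)] with l hl
  have hl0 : 0 < ‖(l : ℂ)‖ := by linarith [norm_nonneg u]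
  have h1 : ‖(l : ℂ)‖ / 2 ≤ ‖u - l‖ := by
    rw [norm_sub_rev]
    exact .trans (by linarith) (norm_sub_norm_le (l : ℂ) u)
  have : ‖(l : ℂ)‖ ^ (-3 : ℝ) = (‖(l : ℂ)‖ ^ 3)⁻¹ := by
    rw [Real.rpow_neg hl0.le]; norm_cast
  rw [this, norm_div, norm_mul, norm_pow, norm_pow]
  calc _ ≤ ‖u‖ ^ 2 / (‖(l : ℂ)‖ ^ 2 * (‖(l : ℂ)‖ / 2)) := by gcongr
    _ = _ := by field_simp

lemma logDeriv_sigmaProd {u : ℂ} (hu : u ∉ L.lattice) :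
    logDeriv (sigmaProd L) u = ∑' l : L.lattice, u ^ 2 / ((l : ℂ) ^ 2 * (u - l)) := by
  have hne (l : L.lattice) : u ≠ l := fun h ↦ hu (h ▸ l.2)
  have := logDeriv_tprod_eq_tsum (f := fun (l : L.lattice) u ↦ sigmaFactor l u)
    (s := Metric.ball (0 : ℂ) (‖u‖ + 1)) (x := u) Metric.isOpen_ball (by simp)
    (fun l ↦ sigmaFactor_ne_zero (.inr (hne l)))
    (fun l ↦ (differentiable_sigmaFactor l).differentiableOn)
    ((summable_logDeriv_sigmaFactor L u).congr fun l ↦ (logDeriv_sigmaFactor (hne l)).symm)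
    (hasProdLocallyUniformlyOn_sigmaFactor L _).multipliableLocallyUniformlyOn
    (sigmaProd_ne_zero L (.inr hu))
  exact this.trans (tsum_congr fun l ↦ logDeriv_sigmaFactor (hne l))

lemma hasDerivAt_div_sq_mul_sub {l u : ℂ} (hu : u ≠ l) :
    HasDerivAt (fun u ↦ u ^ 2 / (l ^ 2 * (u - l)))
      (-(if l = 0 then 0 else 1 / (u - l) ^ 2 - 1 / l ^ 2)) u := by
  rcases eq_or_ne l 0 with rfl | hl
  · simpa using hasDerivAt_const u (0 : ℂ)
  have h : u - l ≠ 0 := sub_ne_zero.mpr hu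
  have := (hasDerivAt_pow 2 u).div (((hasDerivAt_id u).sub_const l).const_mul (l ^ 2))
    (mul_ne_zero (pow_ne_zero 2 hl) h)
  rw [if_neg hl]
  convert! this using 1
  simp only [id]
  field_simp
  push_cast
  ring

/-- Termwise differentiation: the differentiated series is, up to sign, that of `℘` without its pole
at `0`, which converges locally uniformly. -/
lemma hasDerivAt_tsum_logDeriv_sigmaFactor {u : ℂ} (hu : u ∉ L.lattice) :
    HasDerivAt (fun u ↦ ∑' l : L.lattice, u ^ 2 / ((l : ℂ) ^ 2 * (u - l)))
      (-L.weierstrassPExcept 0 u) u := by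
  have h := (L.hasSumLocallyUniformly_weierstrassPExcept 0)
  rw [hasSumLocallyUniformly_iff_tendstoLocallyUniformly] at h
  refine hasDerivAt_of_tendstoLocallyUniformlyOn (l := atTop)
    (f := fun (T : Finset L.lattice) u ↦ ∑ l ∈ T, u ^ 2 / ((l : ℂ) ^ 2 * (u - l)))
    (s := (L.lattice : Set ℂ)ᶜ) L.isClosed_lattice.isOpen_compl
    (h.neg.tendstoLocallyUniformlyOn) ?_ ?_ hu
  · refine .of_forall fun T x hx ↦ ?_
    simp only [Pi.neg_apply]
    rw [← Finset.sum_neg_distrib]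
    exact HasDerivAt.fun_sum fun l _ ↦ hasDerivAt_div_sq_mul_sub fun h ↦ hx (h ▸ l.2)
  · exact fun x _ ↦ (summable_logDeriv_sigmaFactor L x).hasSum

lemma logDeriv_sigma {u : ℂ} (hu : u ∉ L.lattice) :
    logDeriv (sigma L) u = 1 / u + ∑' l : L.lattice, u ^ 2 / ((l : ℂ) ^ 2 * (u - l)) := by
  have h : sigma L = fun u ↦ u * sigmaProd L u := funext (sigma_eq_mul_sigmaProd L)
  have h0 : u ≠ 0 := fun h0 ↦ hu (h0 ▸ zero_mem _)
  rw [h, logDeriv_mul u h0 (sigmaProd_ne_zero L (.inr hu)) differentiableAt_fun_id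
    (differentiable_sigmaProd L u), logDeriv_sigmaProd L hu]
  simp [logDeriv_apply]

/-- `ζ' = -℘` off the lattice. -/
lemma hasDerivAt_logDeriv_sigma {u : ℂ} (hu : u ∉ L.lattice) :
    HasDerivAt (logDeriv (sigma L)) (-L.weierstrassP u) u := by
  have h0 : u ≠ 0 := fun h0 ↦ hu (h0 ▸ zero_mem _)
  have h1 : HasDerivAt (fun u : ℂ ↦ 1 / u) (-(u ^ 2)⁻¹) u := by
    simpa using hasDerivAt_inv h0
  have h := h1.add (hasDerivAt_tsum_logDeriv_sigmaFactor L hu)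
  have e : -L.weierstrassP u = -(u ^ 2)⁻¹ + -L.weierstrassPExcept 0 u := by
    have := L.weierstrassPExcept_add 0 u
    simp at this
    rw [← this]; ring
  rw [e]
  refine h.congr_of_eventuallyEq ?_
  filter_upwards [L.isClosed_lattice.isOpen_compl.mem_nhds hu] with v hv
  exact logDeriv_sigma L hv

/-! ### Quasi-periodicity and simplicity of the zeros. -/

lemma countable_lattice : (L.lattice : Set ℂ).Countable :=
  Set.countable_coe_iff.mp L.latticeEquivProd.toEquiv.injective.countable

lemma isPreconnected_compl_lattice : IsPreconnected (L.lattice : Set ℂ)ᶜ :=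
  ((countable_lattice L).isConnected_compl_of_one_lt_rank
    (by rw [Complex.rank_real_complex]; norm_num)).isPreconnected

lemma dense_compl_lattice : Dense (L.lattice : Set ℂ)ᶜ := (countable_lattice L).dense_compl ℂ

/-- Quasi-periodicity of the sigma function. -/
theorem sigma_add_lattice {l : ℂ} (hl : l ∈ L.lattice) :
    ∃ C η : ℂ, C ≠ 0 ∧ ∀ u, sigma L (u + l) = C * Complex.exp (η * u) * sigma L u := by
  have hmem {u : ℂ} (hu : u ∈ (L.lattice : Set ℂ)ᶜ) : u + l ∉ L.lattice :=
    fun h ↦ hu (by simpa using sub_mem h hl)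
  -- `ζ(u+l) - ζ(u)` has derivative `-℘(u+l) + ℘(u) = 0`, and the complement of the lattice is
  -- connected; hence a constant `η`.
  have hd (u : ℂ) (hu : u ∈ (L.lattice : Set ℂ)ᶜ) :
      HasDerivAt (fun u ↦ logDeriv (sigma L) (u + l) - logDeriv (sigma L) u) 0 u := by
    have h1 := (hasDerivAt_logDeriv_sigma L (hmem hu)).comp_add_const u l
    have h2 := h1.sub (hasDerivAt_logDeriv_sigma L hu)
    rw [L.weierstrassP_add_coe u ⟨l, hl⟩, sub_self] at h2
    exact h2
  obtain ⟨η, hη⟩ := L.isClosed_lattice.isOpen_compl.exists_is_const_of_deriv_eq_zero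
    (isPreconnected_compl_lattice L)
    (fun u hu ↦ (hd u hu).differentiableAt.differentiableWithinAt) (fun u hu ↦ (hd u hu).deriv)
  -- Second integration: by the choice of `η`, the function `σ(u+l) e^{-ηu} / σ(u)` is constant off
  -- the lattice. Density then extends the relation to all `u`.
  have hq (u : ℂ) (hu : u ∈ (L.lattice : Set ℂ)ᶜ) :
      HasDerivAt (fun u ↦ sigma L (u + l) / sigma L u * Complex.exp (-(η * u))) 0 u := by
    have hs0 := sigma_ne_zero L hu
    have hs1 := sigma_ne_zero L (hmem hu)
    have h1 := (differentiable_sigma L (u + l)).hasDerivAt.comp_add_const u l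
    have h2 := (h1.div (differentiable_sigma L u).hasDerivAt hs0).mul
      ((hasDerivAt_id u).const_mul η).neg.cexp
    convert! h2 using 1
    have h3 := hη u hu
    rw [logDeriv_apply, logDeriv_apply, div_sub_div _ _ hs1 hs0,
      div_eq_iff (mul_ne_zero hs1 hs0)] at h3
    simp only [id, mul_one, Pi.div_apply, Pi.neg_apply]
    field_simp
    linear_combination -Complex.exp (-(u * η)) * h3
  obtain ⟨C, hC⟩ := L.isClosed_lattice.isOpen_compl.exists_is_const_of_deriv_eq_zero
    (isPreconnected_compl_lattice L)
    (fun u hu ↦ (hq u hu).differentiableAt.differentiableWithinAt) (fun u hu ↦ (hq u hu).deriv)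
  refine ⟨C, η, ?_, fun u ↦ ?_⟩
  · obtain ⟨u, hu⟩ := (dense_compl_lattice L).nonempty
    rw [← hC u hu]
    exact mul_ne_zero (div_ne_zero (sigma_ne_zero L (hmem hu)) (sigma_ne_zero L hu))
      (Complex.exp_ne_zero _)
  · have hc := continuous_sigma L
    refine congrFun (Continuous.ext_on (dense_compl_lattice L) (f := fun u ↦ sigma L (u + l))
      (g := fun u ↦ C * Complex.exp (η * u) * sigma L u) (by fun_prop) (by fun_prop) ?_) u
    intro u hu
    have hs0 := sigma_ne_zero L hu
    simp only [← hC u hu, Complex.exp_neg]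
    have := Complex.exp_ne_zero (η * u)
    field_simp

lemma sigma_eq_zero_iff {u : ℂ} : sigma L u = 0 ↔ u ∈ L.lattice := by
  refine ⟨fun h ↦ by_contra fun h' ↦ sigma_ne_zero L h' h, fun h ↦ ?_⟩
  obtain ⟨C, η, -, h⟩ := sigma_add_lattice L h
  simpa [sigma_zero] using h 0

/-- Differentiating the quasi-periodicity relation at `0` reduces this to `σ'(0) = 1`. -/
lemma deriv_sigma_ne_zero {l : ℂ} (hl : l ∈ L.lattice) : deriv (sigma L) l ≠ 0 := by
  obtain ⟨C, η, hC, h⟩ := sigma_add_lattice L hl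
  have h1 : HasDerivAt (fun u ↦ sigma L (u + l)) (deriv (sigma L) l) 0 := by
    have := (differentiable_sigma L (0 + l)).hasDerivAt.comp_add_const 0 l
    rwa [zero_add] at this
  have h2 := ((((hasDerivAt_id (0 : ℂ)).const_mul η).cexp).const_mul C).mul
    (differentiable_sigma L 0).hasDerivAt
  rw [funext h] at h1
  have := h1.unique h2
  simp [sigma_zero, deriv_sigma_zero] at this
  rwa [this]

/-! ### Liouville's theorem and the three-term identity. -/

/-- If every zero of the entire function `g` is simple and is a zero of the entire function `f`,
then `g` divides `f` among the entire functions. -/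
lemma exists_differentiable_eq_mul {f g : ℂ → ℂ} (hf : Differentiable ℂ f)
    (hg : Differentiable ℂ g) (h : ∀ p, g p = 0 → f p = 0 ∧ deriv g p ≠ 0) :
    ∃ q : ℂ → ℂ, Differentiable ℂ q ∧ ∀ u, f u = q u * g u := by
  classical
  refine ⟨fun u ↦ if g u = 0 then deriv f u / deriv g u else f u / g u, fun p ↦ ?_, fun u ↦ ?_⟩
  · by_cases hp : g p = 0
    · obtain ⟨hfp, hgp⟩ := h p hp
      -- Near a common zero `p`, both functions are divided by `u - p`; the quotient of the two
      -- slopes is regular there since `g'(p) ≠ 0`.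
      have d (f : ℂ → ℂ) (hf : Differentiable ℂ f) : Differentiable ℂ (dslope f p) := by
        rw [← differentiableOn_univ, Complex.differentiableOn_dslope univ_mem,
          differentiableOn_univ]
        exact hf
      have e (f : ℂ → ℂ) (hf : f p = 0) (u : ℂ) : f u = (u - p) * dslope f p u := by
        have := sub_smul_dslope f p u
        rw [hf, sub_zero] at this
        exact this.symm
      have hne : dslope g p p ≠ 0 := by rwa [dslope_same]
      refine ((d f hf p).div (d g hg p) hne).congr_of_eventuallyEq ?_
      filter_upwards [(d g hg).continuous.continuousAt.eventually_ne hne] with u hu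
      rcases eq_or_ne u p with rfl | hup
      · simp [hp]
      · have hup' : u - p ≠ 0 := sub_ne_zero.mpr hup
        rw [if_neg (by rw [e g hp]; exact mul_ne_zero hup' hu), e f hfp, e g hp, Pi.div_apply,
          mul_div_mul_left _ _ hup']
    · refine ((hf p).div (hg p) hp).congr_of_eventuallyEq ?_
      filter_upwards [hg.continuous.continuousAt.eventually_ne hp] with u hu
      simp [hu]
  · by_cases hu : g u = 0
    · simp [hu, (h u hu).1]
    · simp [hu]

/-- Liouville's theorem for quotients of theta functions with the same multipliers. -/
lemma exists_eq_const_mul_of_quasiperiodic {f g : ℂ → ℂ} (hf : Differentiable ℂ f)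
    (hg : Differentiable ℂ g) (h : ∀ p, g p = 0 → f p = 0 ∧ deriv g p ≠ 0)
    (hdense : Dense {u | g u ≠ 0})
    (hper : ∀ l ∈ L.lattice, ∀ u, ∃ m, m ≠ 0 ∧ f (u + l) = m * f u ∧ g (u + l) = m * g u) :
    ∃ c, ∀ u, f u = c * g u := by
  obtain ⟨q, hq, hqe⟩ := exists_differentiable_eq_mul hf hg h
  have hqp (l : ℂ) (hl : l ∈ L.lattice) (u : ℂ) : q (u + l) = q u := by
    refine congrFun (Continuous.ext_on hdense (f := fun u ↦ q (u + l)) (g := q)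
      (by have := hq.continuous; fun_prop) hq.continuous fun u hu ↦ ?_) u
    obtain ⟨m, hm, h1, h2⟩ := hper l hl u
    rw [hqe, hqe u, h2] at h1
    exact mul_right_cancel₀ (mul_ne_zero hm hu) (h1.trans (by ring))
  refine ⟨q 0, fun u ↦ ?_⟩
  rw [hqe u, hq.apply_eq_apply_of_bounded (IsZLattice.isCompact_range_of_periodic L.lattice _
    hq.continuous fun z w hw ↦ hqp w hw z).isBounded u 0]

lemma dense_setOf_sigma_ne_zero {φ : ℂ → ℂ} (hφ : Function.Injective φ) :
    Dense {u | sigma L (φ u) ≠ 0} := by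
  refine (((countable_lattice L).preimage hφ).dense_compl ℂ).mono fun u hu ↦ ?_
  exact sigma_ne_zero L hu

lemma isOpen_setOf_sigma_ne_zero {φ : ℂ → ℂ} (hφ : Continuous φ) :
    IsOpen {u | sigma L (φ u) ≠ 0} :=
  isOpen_ne_fun ((continuous_sigma L).comp hφ) continuous_const

/-- The three-term identity for the sigma function, in generic position. -/
lemma sigma_three_term_of_ne {b c d : ℂ} (h2d : sigma L (2 * d) ≠ 0)
    (hbd : sigma L (b + d) ≠ 0) (hbd' : sigma L (b - d) ≠ 0) (a : ℂ) :
    sigma L (a + d) * sigma L (a - d) * (sigma L (b + c) * sigma L (b - c)) =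
      sigma L (c + d) * sigma L (c - d) * (sigma L (b + a) * sigma L (b - a)) +
      sigma L (b + d) * sigma L (b - d) * (sigma L (a + c) * sigma L (a - c)) := by
  have hs := differentiable_sigma L
  have sub_rev (x y : ℂ) : sigma L (x - y) = -sigma L (y - x) := by rw [← sigma_neg, neg_sub]
  -- As functions of `a`, the defect `f` of the identity and `g` have the same multipliers. Since
  -- `2d` is off the lattice, `g` has simple zeros, at `±d` modulo the lattice, where `f` also
  -- vanishes. Hence `f = k g`, and `a = b` gives `k = 0`.
  set f : ℂ → ℂ := fun a ↦
    sigma L (a + d) * sigma L (a - d) * (sigma L (b + c) * sigma L (b - c)) -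
      sigma L (c + d) * sigma L (c - d) * (sigma L (b + a) * sigma L (b - a)) -
      sigma L (b + d) * sigma L (b - d) * (sigma L (a + c) * sigma L (a - c)) with hf
  set g : ℂ → ℂ := fun a ↦ sigma L (a + d) * sigma L (a - d) with hg
  -- The multiplier does not depend on `e`: the factors `exp(±ηe)` cancel in the product.
  have hquasi (l : ℂ) (hl : l ∈ L.lattice) (u : ℂ) :
      ∃ m, m ≠ 0 ∧ ∀ e, sigma L (u + l + e) * sigma L (u + l - e) =
        m * (sigma L (u + e) * sigma L (u - e)) := by
    obtain ⟨C, η, hC, h⟩ := sigma_add_lattice L hl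
    refine ⟨C ^ 2 * (Complex.exp (η * u)) ^ 2,
      mul_ne_zero (pow_ne_zero 2 hC) (pow_ne_zero 2 (Complex.exp_ne_zero _)), fun e ↦ ?_⟩
    rw [show u + l + e = u + e + l by ring, show u + l - e = u - e + l by ring, h, h, mul_add,
      mul_sub, Complex.exp_add, Complex.exp_sub]
    have := Complex.exp_ne_zero (η * e)
    field_simp
  have hfper (l : ℂ) (hl : l ∈ L.lattice) (u : ℂ) :
      ∃ m, m ≠ 0 ∧ f (u + l) = m * f u ∧ g (u + l) = m * g u := by
    obtain ⟨m, hm, h⟩ := hquasi l hl u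
    refine ⟨m, hm, ?_, h d⟩
    simp only [hf]
    rw [h, h, sub_rev b (u + l), sub_rev b u, add_comm b (u + l), add_comm b u]
    linear_combination (sigma L (c + d) * sigma L (c - d)) * h b
  have hfd : f d = 0 := by
    simp only [hf, sub_self, sigma_zero]
    rw [sub_rev d c, add_comm d c]
    ring
  have hfd' : f (-d) = 0 := by
    simp only [hf, neg_add_cancel, sigma_zero, ← sub_eq_add_neg, sub_neg_eq_add]
    rw [show -d + c = c - d by ring, show -d - c = -(c + d) by ring, sigma_neg]
    ring
  have hzero (p : ℂ) (hp : g p = 0) : f p = 0 ∧ deriv g p ≠ 0 := by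
    have hderiv : deriv g p =
        deriv (sigma L) (p + d) * sigma L (p - d) + sigma L (p + d) * deriv (sigma L) (p - d) :=
      (((hs (p + d)).hasDerivAt.comp_add_const p d).mul
        ((hs (p - d)).hasDerivAt.comp_sub_const p d)).deriv
    have h2d' : 2 * d ∉ L.lattice := fun h ↦ h2d ((sigma_eq_zero_iff L).mpr h)
    have aux (e : ℂ) (he : f e = 0) (hp : p - e ∈ L.lattice) : f p = 0 := by
      obtain ⟨m, -, h, -⟩ := hfper _ hp e
      rwa [add_sub_cancel, he, mul_zero] at h
    rcases mul_eq_zero.mp hp with h | h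
    · have h' := (sigma_eq_zero_iff L).mp h
      refine ⟨aux (-d) hfd' (by simpa using h'), ?_⟩
      rw [hderiv, h, zero_mul, add_zero]
      refine mul_ne_zero (deriv_sigma_ne_zero L h') (sigma_ne_zero L fun h'' ↦ h2d' ?_)
      convert! sub_mem h' h'' using 1
      ring
    · have h' := (sigma_eq_zero_iff L).mp h
      refine ⟨aux d hfd h', ?_⟩
      rw [hderiv, h, mul_zero, zero_add]
      refine mul_ne_zero (sigma_ne_zero L fun h'' ↦ h2d' ?_) (deriv_sigma_ne_zero L h')
      convert! sub_mem h'' h' using 1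
      ring
  have hdense : Dense {u | g u ≠ 0} := by
    refine ((dense_setOf_sigma_ne_zero L (φ := (· + d)) (add_left_injective d)).inter_of_isOpen_left
      (dense_setOf_sigma_ne_zero L (φ := (· - d)) sub_left_injective)
      (isOpen_setOf_sigma_ne_zero L (by fun_prop))).mono fun u hu ↦ mul_ne_zero hu.1 hu.2
  obtain ⟨k, hk⟩ := exists_eq_const_mul_of_quasiperiodic L (f := f) (g := g) (by fun_prop)
    (by fun_prop) hzero hdense hfper
  have hfb : f b = 0 := by
    simp only [hf, sub_self, sigma_zero]
    ring
  rw [hk b] at hfb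
  have hk0 : k = 0 := (mul_eq_zero.mp hfb).resolve_right (mul_ne_zero hbd hbd')
  have := hk a
  rw [hk0, zero_mul] at this
  linear_combination this

/-- The three-term identity for the sigma function. -/
theorem sigma_three_term (a b c d : ℂ) :
    sigma L (a + d) * sigma L (a - d) * (sigma L (b + c) * sigma L (b - c)) =
      sigma L (c + d) * sigma L (c - d) * (sigma L (b + a) * sigma L (b - a)) +
      sigma L (b + d) * sigma L (b - d) * (sigma L (a + c) * sigma L (a - c)) := by
  have hc := continuous_sigma L
  have hdense : Dense ({d | sigma L (2 * d) ≠ 0} ∩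
      ({d | sigma L (b + d) ≠ 0} ∩ {d | sigma L (b - d) ≠ 0})) := by
    refine (dense_setOf_sigma_ne_zero L (mul_right_injective₀ two_ne_zero)).inter_of_isOpen_left
      ?_ (isOpen_setOf_sigma_ne_zero L (by fun_prop))
    exact (dense_setOf_sigma_ne_zero L (add_right_injective b)).inter_of_isOpen_left
      (dense_setOf_sigma_ne_zero L sub_right_injective)
      (isOpen_setOf_sigma_ne_zero L (by fun_prop))
  exact congrFun (Continuous.ext_on hdense (f := fun d ↦
    sigma L (a + d) * sigma L (a - d) * (sigma L (b + c) * sigma L (b - c))) (g := fun d ↦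
      sigma L (c + d) * sigma L (c - d) * (sigma L (b + a) * sigma L (b - a)) +
      sigma L (b + d) * sigma L (b - d) * (sigma L (a + c) * sigma L (a - c)))
    (by fun_prop) (by fun_prop)
    fun d hd ↦ sigma_three_term_of_ne L hd.1 hd.2.1 hd.2.2 a) d

lemma sigma_sub_rev (x y : ℂ) : sigma L (x - y) = -sigma L (y - x) := by rw [← sigma_neg, neg_sub]

/-- The three-term identity recentred at `(x+y)/2`, with `d = (x-y)/2`. The factors in `k` on the
left are those of the numerator of a partial fraction term. -/
lemma sigma_three_term_sub (k p q x y : ℂ) :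
    sigma L (k - x) * sigma L (k - y) * (sigma L (p - q) * sigma L (p + q - (x + y))) =
      sigma L (q - x) * sigma L (q - y) * (sigma L (p - k) * sigma L (p + k - (x + y))) +
      sigma L (p - x) * sigma L (p - y) * (sigma L (k - q) * sigma L (k + q - (x + y))) := by
  have := sigma_three_term L (k - (x + y) / 2) (p - (x + y) / 2) (q - (x + y) / 2) ((x - y) / 2)
  ring_nf at this ⊢
  exact this

/-! ### Elliptic partial fractions. -/

section PartialFractions

variable {ι : Type*} [DecidableEq ι] {a : ι → ℂ}

/-- The term `∏_b σ(a_k - b) / ∏_{j ≠ k} σ(a_k - a_j)` of the elliptic partial fraction sum. -/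
def sigmaFracTerm (A : Finset ι) (a : ι → ℂ) (B : Multiset ℂ) (k : ι) : ℂ :=
  (B.map fun b ↦ sigma L (a k - b)).prod / ∏ j ∈ A.erase k, sigma L (a k - a j)

/-- The factor `σ(a_p - a_k)` kills the term `k = p` and elsewhere cancels a denominator; the other
factor acts as a new numerator point `t - a_p`. This is the sum for one node fewer. -/
lemma sum_mul_sigmaFracTerm_of_erase {A : Finset ι}
    (hA : ∀ i ∈ A, ∀ j ∈ A, i ≠ j → sigma L (a i - a j) ≠ 0) {B : Multiset ℂ} {p : ι}
    (hp : p ∈ A) {t : ℂ}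
    (ih : ∑ k ∈ A.erase p, sigmaFracTerm L (A.erase p) a ((t - a p) ::ₘ B) k = 0) :
    ∑ k ∈ A, sigma L (a p - a k) * sigma L (a p + a k - t) * sigmaFracTerm L A a B k = 0 := by
  rw [← Finset.sum_erase A (a := p) (by simp [sigma_zero]), ← neg_eq_zero,
    ← Finset.sum_neg_distrib, ← ih]
  refine Finset.sum_congr rfl fun k hk ↦ ?_
  obtain ⟨hkp, hkA⟩ := Finset.mem_erase.mp hk
  have h1 : ∏ j ∈ A.erase k, sigma L (a k - a j) =
      sigma L (a k - a p) * ∏ j ∈ (A.erase p).erase k, sigma L (a k - a j) := by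
    rw [Finset.erase_right_comm, Finset.mul_prod_erase (A.erase k) (fun j ↦ sigma L (a k - a j))
      (Finset.mem_erase.mpr ⟨hkp.symm, hp⟩)]
  have h2 := hA k hkA p hp hkp
  rw [sigmaFracTerm, sigmaFracTerm, h1, sigma_sub_rev L (a p), Multiset.map_cons,
    Multiset.prod_cons, show a k - (t - a p) = a p + a k - t by ring]
  generalize ∏ j ∈ (A.erase p).erase k, sigma L (a k - a j) = R
  rcases eq_or_ne R 0 with rfl | hR
  · simp
  · field_simp

/-- The three-term identity writes `σ(a_k-x) σ(a_k-y)`, times a nonzero constant, as a combination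
of the two weights that remove node `p` or node `q`. -/
lemma sum_sigmaFracTerm_of_erase {A : Finset ι}
    (hA : ∀ i ∈ A, ∀ j ∈ A, i ≠ j → sigma L (a i - a j) ≠ 0) {B : Multiset ℂ} {p q : ι}
    (hp : p ∈ A) (hq : q ∈ A) (hpq : p ≠ q) {x y : ℂ}
    (hxy : sigma L (a p + a q - (x + y)) ≠ 0)
    (ihp : ∑ k ∈ A.erase p, sigmaFracTerm L (A.erase p) a ((x + y - a p) ::ₘ B) k = 0)
    (ihq : ∑ k ∈ A.erase q, sigmaFracTerm L (A.erase q) a ((x + y - a q) ::ₘ B) k = 0) :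
    ∑ k ∈ A, sigmaFracTerm L A a (x ::ₘ y ::ₘ B) k = 0 := by
  have hp' := sum_mul_sigmaFracTerm_of_erase L hA hp ihp
  have hq' := sum_mul_sigmaFracTerm_of_erase L hA hq ihq
  refine (mul_eq_zero.mp ?_).resolve_right (mul_ne_zero (hA p hp q hq hpq) hxy)
  calc _ = sigma L (a q - x) * sigma L (a q - y) * (∑ k ∈ A,
          sigma L (a p - a k) * sigma L (a p + a k - (x + y)) * sigmaFracTerm L A a B k) -
        sigma L (a p - x) * sigma L (a p - y) * (∑ k ∈ A,
          sigma L (a q - a k) * sigma L (a q + a k - (x + y)) * sigmaFracTerm L A a B k) := by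
        rw [Finset.mul_sum, Finset.mul_sum, Finset.sum_mul, ← Finset.sum_sub_distrib]
        refine Finset.sum_congr rfl fun k _ ↦ ?_
        have h := sigma_three_term_sub L (a k) (a p) (a q) x y
        rw [sigma_sub_rev L (a k) (a q), add_comm (a k) (a q)] at h
        simp only [sigmaFracTerm, Multiset.map_cons, Multiset.prod_cons]
        linear_combination (B.map fun b ↦ sigma L (a k - b)).prod /
          (∏ j ∈ A.erase k, sigma L (a k - a j)) * h
    _ = 0 := by rw [hp', hq']; ring

/-- Elliptic partial fractions: if `∑ a_k = ∑ b_j`, then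
`∑_k ∏_j σ(a_k - b_j) / ∏_{j ≠ k} σ(a_k - a_j) = 0`. -/
theorem sum_sigmaFracTerm (A : Finset ι)
    (hA : ∀ i ∈ A, ∀ j ∈ A, i ≠ j → sigma L (a i - a j) ≠ 0) (B : Multiset ℂ)
    (hcard : B.card = A.card) (hsum : B.sum = ∑ i ∈ A, a i) :
    ∑ k ∈ A, sigmaFracTerm L A a B k = 0 := by
  induction hn : A.card using Nat.strong_induction_on generalizing A B with
  | _ n ih =>
  subst hn
  have herase (p : ι) (hp : p ∈ A) (x y : ℂ) (B' : Multiset ℂ)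
      (hc : (x ::ₘ y ::ₘ B').card = A.card) (hs : (x ::ₘ y ::ₘ B').sum = ∑ i ∈ A, a i) :
      ∑ k ∈ A.erase p, sigmaFracTerm L (A.erase p) a ((x + y - a p) ::ₘ B') k = 0 := by
    refine ih _ (Finset.card_erase_lt_of_mem hp) _ (fun i hi j hj ↦
      hA i (Finset.mem_of_mem_erase hi) j (Finset.mem_of_mem_erase hj)) _ ?_ ?_ rfl
    · rw [Finset.card_erase_of_mem hp, ← hc]; simp
    · rw [← Finset.add_sum_erase _ _ hp] at hs
      simp only [Multiset.sum_cons] at hs ⊢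
      linear_combination hs
  rcases Nat.lt_or_ge A.card 3 with h3 | h3
  · interval_cases h : A.card
    · simp [Finset.card_eq_zero.mp h]
    · obtain ⟨p, rfl⟩ := Finset.card_eq_one.mp h
      obtain ⟨x, rfl⟩ := Multiset.card_eq_one.mp hcard
      simp only [Multiset.sum_singleton, Finset.sum_singleton] at hsum
      simp [sigmaFracTerm, hsum, sigma_zero]
    · obtain ⟨p, q, hpq, rfl⟩ := Finset.card_eq_two.mp h
      obtain ⟨x, y, rfl⟩ := Multiset.card_eq_two.mp hcard
      simp only [Multiset.insert_eq_cons, Multiset.sum_cons, Multiset.sum_singleton,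
        Finset.sum_pair hpq] at hsum
      have e1 : ({p, q} : Finset ι).erase p = {q} := by
        rw [Finset.erase_insert (by simpa using hpq)]
      have e2 : ({p, q} : Finset ι).erase q = {p} := by
        rw [Finset.pair_comm, Finset.erase_insert (by simpa using hpq.symm)]
      rw [Finset.sum_pair hpq]
      simp only [sigmaFracTerm, e1, e2, Finset.prod_singleton, Multiset.insert_eq_cons,
        Multiset.map_cons, Multiset.map_singleton, Multiset.prod_cons, Multiset.prod_singleton]
      rw [sigma_sub_rev L (a q) (a p), show a q - x = -(a p - y) by linear_combination -hsum,
        show a q - y = -(a p - x) by linear_combination -hsum, sigma_neg, sigma_neg]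
      ring
  -- The reduction needs `a_p + a_q - (x+y)` off the lattice. Moving `x` to `x+e` and a third point
  -- `v` to `v-e` keeps the total and makes this generic; continuity gives `e = 0`.
  · obtain ⟨p, hp, q, hq, hpq⟩ := Finset.one_lt_card.mp (by lia : 1 < A.card)
    have hc3 : 3 ≤ B.card := hcard ▸ h3
    obtain ⟨x, hx⟩ := Multiset.card_pos_iff_exists_mem.mp (by lia : 0 < B.card)
    obtain ⟨B, rfl⟩ := Multiset.exists_cons_of_mem hx
    rw [Multiset.card_cons] at hc3
    obtain ⟨v, hv⟩ := Multiset.card_pos_iff_exists_mem.mp (by lia : 0 < B.card)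
    obtain ⟨B, rfl⟩ := Multiset.exists_cons_of_mem hv
    rw [Multiset.card_cons] at hc3
    obtain ⟨y, hy⟩ := Multiset.card_pos_iff_exists_mem.mp (by lia : 0 < B.card)
    obtain ⟨B, rfl⟩ := Multiset.exists_cons_of_mem hy
    have hσ := continuous_sigma L
    have hcont : Continuous fun e : ℂ ↦
        ∑ k ∈ A, sigmaFracTerm L A a ((x + e) ::ₘ y ::ₘ (v - e) ::ₘ B) k := by
      simp only [sigmaFracTerm, Multiset.map_cons, Multiset.prod_cons, div_eq_mul_inv]
      fun_prop
    have hdense : Dense {e | sigma L (a p + a q - (x + e + y)) ≠ 0} :=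
      dense_setOf_sigma_ne_zero L (φ := fun e ↦ a p + a q - (x + e + y)) fun e f h ↦ by
        simpa using h
    have key := congrFun (Continuous.ext_on hdense hcont continuous_zero fun e he ↦ ?_) 0
    · rw [Multiset.cons_swap v y]
      simpa using key
    · have hc : ((x + e) ::ₘ y ::ₘ (v - e) ::ₘ B).card = A.card := by
        rw [← hcard]; simp
      have hs : ((x + e) ::ₘ y ::ₘ (v - e) ::ₘ B).sum = ∑ i ∈ A, a i := by
        rw [← hsum]; simp only [Multiset.sum_cons]; ring
      exact sum_sigmaFracTerm_of_erase L hA hp hq hpq he (herase p hp _ _ _ hc hs)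
        (herase q hq _ _ _ hc hs)

end PartialFractions

/-! ### From orthogonality to the determinant. -/

/-- The matrix sends the vector `q` to `Q` times the last basis vector. Applying the adjugate and
reading the last entry gives the equality, the last cofactor being `Δ_n`. -/
lemma lbp_det_mul_eq (c : ℤ → ℂ) (n : ℕ) (q : ℕ → ℂ)
    (hq : ∀ i < n, ∑ j ∈ Finset.range (n + 1), q j * c ((j : ℤ) - i) = 0) :
    (Matrix.of fun i j : Fin (n + 1) =>
      if (i : ℕ) < n then C (c ((j : ℤ) - (i : ℤ))) else (X : ℂ[X]) ^ (j : ℕ)).det * C (q n) =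
      C (toeplitzDet c n) * ∑ j ∈ Finset.range (n + 1), C (q j) * X ^ j := by
  set M : Matrix (Fin (n + 1)) (Fin (n + 1)) ℂ[X] := Matrix.of fun i j : Fin (n + 1) =>
      if (i : ℕ) < n then C (c ((j : ℤ) - (i : ℤ))) else (X : ℂ[X]) ^ (j : ℕ) with hM
  set Q : ℂ[X] := ∑ j ∈ Finset.range (n + 1), C (q j) * X ^ j with hQ
  have h1 : M.mulVec (fun j ↦ C (q j)) = Pi.single (Fin.last n) Q := by
    ext1 i
    rw [Matrix.mulVec, dotProduct]
    by_cases hi : (i : ℕ) < n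
    · rw [Pi.single_eq_of_ne (by rintro rfl; simp at hi)]
      have := congrArg (C : ℂ → ℂ[X]) (hq i hi)
      rw [← Fin.sum_univ_eq_sum_range (fun j ↦ q j * c ((j : ℤ) - (i : ℕ))), map_sum, C_0] at this
      rw [← this]
      refine Finset.sum_congr rfl fun j _ ↦ ?_
      rw [hM, Matrix.of_apply, if_pos hi, ← C_mul, mul_comm]
    · obtain rfl : i = Fin.last n := by
        ext; simp only [Fin.val_last]; lia
      rw [Pi.single_eq_same, hQ, ← Fin.sum_univ_eq_sum_range (fun j ↦ C (q j) * (X : ℂ[X]) ^ j)]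
      refine Finset.sum_congr rfl fun j _ ↦ ?_
      rw [hM, Matrix.of_apply, if_neg (by simp), mul_comm]
  have h2 : M.adjugate (Fin.last n) (Fin.last n) = C (toeplitzDet c n) := by
    rw [Matrix.adjugate_fin_succ_eq_det_submatrix, toeplitzDet, RingHom.map_det,
      Even.neg_one_pow (by simp), one_mul]
    congr 1
    ext1 i j
    simp [hM]
  have h3 := congrArg (fun v ↦ M.adjugate.mulVec v (Fin.last n)) h1
  simp only [Matrix.mulVec_mulVec, Matrix.adjugate_mul, Matrix.mulVec_single] at h3
  rw [Matrix.smul_mulVec, Matrix.one_mulVec] at h3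
  simpa [h2, mul_comm] using h3

lemma lbp_eq_of_sum_eq_zero {c : ℤ → ℂ} {n : ℕ} (hΔ : toeplitzDet c n ≠ 0) {q : ℕ → ℂ}
    (hq : ∀ i < n, ∑ j ∈ Finset.range (n + 1), q j * c ((j : ℤ) - i) = 0) (hq0 : q 0 ≠ 0) :
    q n ≠ 0 ∧ lbp c n = C (q n)⁻¹ * ∑ j ∈ Finset.range (n + 1), C (q j) * X ^ j := by
  have h := lbp_det_mul_eq c n q hq
  -- If `q n` vanished, so would `∑ q_j X^j`, against `q 0 ≠ 0`.
  have hqn : q n ≠ 0 := by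
    intro h0
    rw [h0, C_0, mul_zero, eq_comm] at h
    have h1 := (mul_eq_zero.mp h).resolve_left (C_ne_zero.mpr hΔ)
    have h2 := congrArg (fun p ↦ coeff p 0) h1
    simp [coeff_X_pow] at h2
    exact hq0 h2
  refine ⟨hqn, ?_⟩
  refine mul_right_cancel₀ (C_ne_zero.mpr hqn) ?_
  rw [lbp, mul_assoc, h, ← mul_assoc, ← C_mul, inv_mul_cancel₀ hΔ, C_1, one_mul, mul_right_comm,
    ← C_mul, inv_mul_cancel₀ hqn, C_1, one_mul]

/-! ### The explicit coefficients and the hypergeometric terms. -/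

/-- The coefficient of `z^s` in a scalar multiple of the Laurent biorthogonal polynomial. -/
def lbpCoeff (w α β γ : ℂ) (n s : ℕ) : ℂ :=
  Complex.exp (-γ * w * s) * (∏ i ∈ Finset.range n, sigma L (α + w * (s - i))) *
    sigma L (β + n * α + w * (n - s)) /
    ∏ j ∈ (Finset.range (n + 1)).erase s, sigma L (w * s - w * j)

lemma prod_erase_sigma (w : ℂ) {n s : ℕ} (hs : s ≤ n) :
    ∏ j ∈ (Finset.range (n + 1)).erase s, sigma L (w * s - w * j) =
      (∏ i ∈ Finset.range s, sigma L (w * (i + 1))) *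
        ∏ i ∈ Finset.range (n - s), sigma L (-(w * (i + 1))) := by
  have h : (Finset.range (n + 1)).erase s = Finset.range s ∪ Finset.Ico (s + 1) (n + 1) := by
    ext; simp; lia
  have hd : Disjoint (Finset.range s) (Finset.Ico (s + 1) (n + 1)) := by
    rw [Finset.disjoint_left]; intro x; simp; lia
  rw [h, Finset.prod_union hd, Finset.prod_Ico_eq_prod_range,
    ← Finset.prod_range_reflect (fun j ↦ sigma L (w * s - w * j)), Nat.add_sub_add_right]
  congr 1
  · refine Finset.prod_congr rfl fun i hi ↦ ?_
    have := Finset.mem_range.mp hi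
    rw [show s - 1 - i = s - (i + 1) by lia, Nat.cast_sub (by lia)]
    push_cast
    ring_nf
  · refine Finset.prod_congr rfl fun i _ ↦ ?_
    push_cast
    ring_nf

lemma ellPoch_succ (w x : ℂ) (k : ℕ) :
    ellPoch L w x (k + 1) = ellPoch L w x k * ellNum L w (x + k) := Finset.prod_range_succ _ _

lemma ellPoch_zero (w x : ℂ) : ellPoch L w x 0 = 1 := Finset.prod_range_zero _

lemma ellM_params (w α β : ℂ) (n : ℕ) :
    ellM L w (upperParams w α β n) (lowerParams w α β n) = 0 := by
  simp only [ellM, upperParams, lowerParams, Fin.sum_univ_succ]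
  simp
  right
  ring

lemma ellHypTerm_mul {r : ℕ} (w : ℂ) (a : Fin (r + 1) → ℂ) (b : Fin r → ℂ) (z e : ℂ) (s : ℕ) :
    ellHypTerm L w a b (z * e) s = ellHypTerm L w a b e s * z ^ s := by
  simp only [ellHypTerm, mul_pow]
  ring

lemma ellHypTerm_params (w α β e : ℂ) (n s : ℕ) :
    ellHypTerm L w (upperParams w α β n) (lowerParams w α β n) e s =
      ellPoch L w (-(n : ℂ)) s * ellPoch L w (α / w + 1) s *
        ellPoch L w (-(α / w + 1) * n - β / w + 1) s /
      (ellPoch L w 1 s * (ellPoch L w (α / w + 1 - n) s *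
        ellPoch L w (-(α / w + 1) * n - β / w) s)) * e ^ s := by
  rw [ellHypTerm, ellM_params]
  simp [upperParams, lowerParams, Fin.prod_univ_succ, mul_assoc]

lemma ellPoch_neg_natCast {n s : ℕ} (w : ℂ) (h : n < s) : ellPoch L w (-(n : ℂ)) s = 0 :=
  Finset.prod_eq_zero (Finset.mem_range.mpr h) (by simp [ellNum, sigma_zero])

lemma ellHypTerm_eq_zero (w α β e : ℂ) {n s : ℕ} (h : n < s) :
    ellHypTerm L w (upperParams w α β n) (lowerParams w α β n) e s = 0 := by
  simp [ellHypTerm_params, ellPoch_neg_natCast L w h]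

lemma ellHypTerm_succ {w : ℂ} (α β e : ℂ) (n s : ℕ) (hw : w ≠ 0) (hσ : sigma L w ≠ 0) :
    ellHypTerm L w (upperParams w α β n) (lowerParams w α β n) e (s + 1) =
      ellHypTerm L w (upperParams w α β n) (lowerParams w α β n) e s *
      (sigma L (-(w * (n - s))) * sigma L (α + w * (s + 1)) *
        sigma L (β + n * α + w * (n - s - 1)) /
        (sigma L (w * (s + 1)) * (sigma L (α + w * (s + 1 - n)) *
          sigma L (β + n * α + w * (n - s)))) * e) := by
  have e1 : ellNum L w (-(n : ℂ) + s) = sigma L (-(w * (n - s))) / sigma L w := by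
    rw [ellNum]; ring_nf
  have e2 : ellNum L w (α / w + 1 + s) = sigma L (α + w * (s + 1)) / sigma L w := by
    rw [ellNum]; congr 2; field_simp; ring
  have e3 : ellNum L w (-(α / w + 1) * n - β / w + 1 + s) =
      -sigma L (β + n * α + w * (n - s - 1)) / sigma L w := by
    rw [ellNum, ← sigma_neg]; congr 2; field_simp; ring
  have e4 : ellNum L w (1 + s) = sigma L (w * (s + 1)) / sigma L w := by
    rw [ellNum, add_comm]
  have e5 : ellNum L w (α / w + 1 - n + s) = sigma L (α + w * (s + 1 - n)) / sigma L w := by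
    rw [ellNum]; congr 2; field_simp; ring
  have e6 : ellNum L w (-(α / w + 1) * n - β / w + s) =
      -sigma L (β + n * α + w * (n - s)) / sigma L w := by
    rw [ellNum, ← sigma_neg]; congr 2; field_simp; ring
  -- The three factors `1/σ(w)` above and below cancel, as do the two signs. Only `σ(w) ≠ 0` is
  -- needed, because `x/0 = 0` keeps division multiplicative.
  have key (a b c d f g x y z u v t k : ℂ) (hk : k ≠ 0) :
      a * (x / k) * (b * (y / k)) * (c * (-z / k)) /
        (d * (u / k) * (f * (v / k) * (g * (-t / k)))) =
      a * b * c / (d * (f * g)) * (x * y * z / (u * (v * t))) := by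
    rw [← mul_div_mul_comm]
    rw [show a * (x / k) * (b * (y / k)) * (c * (-z / k)) =
        a * b * c * (x * y * z) * (-(1 / k ^ 3)) by field_simp,
      show d * (u / k) * (f * (v / k) * (g * (-t / k))) =
        d * (f * g) * (u * (v * t)) * (-(1 / k ^ 3)) by field_simp,
      mul_div_mul_right]
    exact neg_ne_zero.mpr (one_div_ne_zero (pow_ne_zero 3 hk))
  rw [ellHypTerm_params, ellHypTerm_params]
  simp only [ellPoch_succ, e1, e2, e3, e4, e5, e6]
  rw [key _ _ _ _ _ _ _ _ _ _ _ _ _ hσ, pow_succ]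
  ring

lemma lbpCoeff_succ {w α β : ℂ} (γ : ℂ) {n s : ℕ} (hs : s < n)
    (hw : ∀ k : ℕ, k ≠ 0 → sigma L (w * k) ≠ 0) (hα : sigma L (α + w * (s + 1 - n)) ≠ 0)
    (hb : sigma L (β + n * α + w * (n - s)) ≠ 0) :
    lbpCoeff L w α β γ n (s + 1) = lbpCoeff L w α β γ n s *
      (sigma L (-(w * (n - s))) * sigma L (α + w * (s + 1)) *
        sigma L (β + n * α + w * (n - s - 1)) /
        (sigma L (w * (s + 1)) * (sigma L (α + w * (s + 1 - n)) *
          sigma L (β + n * α + w * (n - s)))) * Complex.exp (-γ * w)) := by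
  have hw' (i : ℕ) : sigma L (w * (i + 1)) ≠ 0 := by
    simpa using hw (i + 1) (Nat.succ_ne_zero i)
  rw [lbpCoeff, lbpCoeff, prod_erase_sigma L w hs, prod_erase_sigma L w hs.le,
    Finset.prod_range_succ, show n - s = n - (s + 1) + 1 by lia, Finset.prod_range_succ]
  have h1 : ((n - (s + 1) : ℕ) : ℂ) + 1 = n - s := by
    rw [Nat.cast_sub hs]; push_cast; ring
  -- Passing from `s` to `s+1` shifts the product: it gains its new first factor and loses its last.
  have h2 : (∏ i ∈ Finset.range n, sigma L (α + w * ((s + 1 : ℕ) - i))) *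
        sigma L (α + w * (s + 1 - n)) =
      (∏ i ∈ Finset.range n, sigma L (α + w * (s - i))) * sigma L (α + w * (s + 1)) := by
    have h3 := Finset.prod_range_succ (fun i : ℕ ↦ sigma L (α + w * ((s + 1 : ℕ) - i))) n
    have h4 := Finset.prod_range_succ' (fun i : ℕ ↦ sigma L (α + w * ((s + 1 : ℕ) - i))) n
    rw [h3] at h4
    simpa using h4
  have h5 : Complex.exp (-γ * w * (s + 1 : ℕ)) =
      Complex.exp (-γ * w * s) * Complex.exp (-γ * w) := by
    rw [← Complex.exp_add]; push_cast; ring_nf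
  have h6 : ∏ i ∈ Finset.range s, sigma L (w * (i + 1)) ≠ 0 :=
    Finset.prod_ne_zero_iff.mpr fun i _ ↦ hw' i
  have h7 : ∏ i ∈ Finset.range (n - (s + 1)), sigma L (-(w * (i + 1))) ≠ 0 :=
    Finset.prod_ne_zero_iff.mpr fun i _ ↦ by rw [sigma_neg]; exact neg_ne_zero.mpr (hw' i)
  have h8 : sigma L (-(w * (n - s))) ≠ 0 := by
    rw [sigma_neg, ← h1]; exact neg_ne_zero.mpr (hw' _)
  have h9 := hw' s
  have h10 : (n : ℂ) - (s + 1 : ℕ) = n - s - 1 := by push_cast; ring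
  rw [h1, h5, h10, eq_div_of_mul_eq hα h2]
  generalize sigma L (β + n * α + w * (n - s)) = t at *
  field_simp

lemma lbpCoeff_zero_eq {w α β : ℂ} (γ : ℂ) {n : ℕ} (hw0 : w ≠ 0)
    (hw : ∀ k : ℕ, k ≠ 0 → sigma L (w * k) ≠ 0)
    (hα : ∀ k : ℕ, sigma L (α + w * k) ≠ 0) (hb : sigma L (β + n * α) ≠ 0) :
    lbpCoeff L w α β γ n 0 = lbpCoeff L w α β γ n n * coeffB L w α β γ n := by
  have hσ : sigma L w ≠ 0 := by simpa using hw 1 one_ne_zero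
  have hw' (i : ℕ) : sigma L (w * (i + 1)) ≠ 0 := by
    simpa using hw (i + 1) (Nat.succ_ne_zero i)
  have e1 : ellPoch L w (-(α / w)) n =
      (-1) ^ n * (∏ i ∈ Finset.range n, sigma L (α + w * ((0 : ℕ) - i))) / sigma L w ^ n := by
    rw [ellPoch, ← Finset.card_range n, ← Finset.prod_const, ← Finset.prod_const,
      Finset.card_range, ← Finset.prod_mul_distrib, ← Finset.prod_div_distrib]
    refine Finset.prod_congr rfl fun i _ ↦ ?_
    rw [ellNum, neg_one_mul, ← sigma_neg]
    congr 2
    push_cast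
    field_simp
    ring
  have e2 : ellPoch L w (α / w + 1) n =
      (∏ i ∈ Finset.range n, sigma L (α + w * ((n : ℕ) - i))) / sigma L w ^ n := by
    rw [ellPoch, ← Finset.prod_range_reflect, ← Finset.card_range n, ← Finset.prod_const,
      Finset.card_range, ← Finset.prod_div_distrib]
    refine Finset.prod_congr rfl fun i hi ↦ ?_
    have := Finset.mem_range.mp hi
    rw [ellNum, show n - 1 - i = n - (i + 1) by lia, Nat.cast_sub (by lia)]
    congr 2
    push_cast
    field_simp
    ring
  have e3 : ellNum L w (α / w * n + β / w + n) = sigma L (β + n * α + w * n) / sigma L w := by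
    rw [ellNum]; congr 2; field_simp; ring
  have e4 : ellNum L w (α / w * n + β / w) = sigma L (β + n * α) / sigma L w := by
    rw [ellNum]; congr 2; field_simp; ring
  -- This sign, from the nodes above `0`, cancels the one in `e1`.
  have h1 : ∏ i ∈ Finset.range n, sigma L (-(w * (i + 1))) =
      (-1) ^ n * ∏ i ∈ Finset.range n, sigma L (w * (i + 1)) := by
    simp [sigma_neg, Finset.prod_neg]
  have h2 : ∏ i ∈ Finset.range n, sigma L (w * (i + 1)) ≠ 0 :=
    Finset.prod_ne_zero_iff.mpr fun i _ ↦ hw' i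
  have h3 : ∏ i ∈ Finset.range n, sigma L (α + w * ((n : ℕ) - i)) ≠ 0 :=
    Finset.prod_ne_zero_iff.mpr fun i hi ↦ by
      rw [← Nat.cast_sub (Finset.mem_range.mp hi).le]; exact hα _
  rw [lbpCoeff, lbpCoeff, prod_erase_sigma L w n.zero_le, prod_erase_sigma L w le_rfl, coeffB,
    e1, e2, e3, e4, Nat.sub_self, Nat.sub_zero, Finset.prod_range_zero, Finset.prod_range_zero, h1]
  have h4 : Complex.exp (-γ * w * n) * Complex.exp (γ * w * n) = 1 := by
    rw [← Complex.exp_add]; simp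
  have h5 : ((-1 : ℂ) ^ n) * (-1) ^ n = 1 := by rw [← mul_pow]; simp
  generalize ∏ i ∈ Finset.range n, sigma L (α + w * ((n : ℕ) - i)) = P at *
  generalize ∏ i ∈ Finset.range n, sigma L (α + w * ((0 : ℕ) - i)) = R at *
  generalize ∏ i ∈ Finset.range n, sigma L (w * (i + 1)) = D at *
  have h6 : (-1 : ℂ) ^ n ≠ 0 := by simp
  simp only [Nat.cast_zero, mul_zero, Complex.exp_zero, sub_zero, sub_self, add_zero, one_mul,
    mul_one]
  generalize sigma L (β + n * α + w * n) = t at *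
  rw [eq_inv_of_mul_eq_one_left h4]
  have h7 := Complex.exp_ne_zero (γ * w * n)
  field_simp
  linear_combination -R * t * h5

lemma lbpCoeff_eq_mul_ellHypTerm {w α β : ℂ} (γ : ℂ) {n : ℕ} (hw0 : w ≠ 0)
    (hw : ∀ k : ℕ, k ≠ 0 → sigma L (w * k) ≠ 0) (hα : ∀ k : ℤ, sigma L (α + w * k) ≠ 0)
    (hb : ∀ s : ℕ, s ≤ n → sigma L (β + n * α + w * (n - s)) ≠ 0) {s : ℕ} (hs : s ≤ n) :
    lbpCoeff L w α β γ n s = lbpCoeff L w α β γ n n * (coeffB L w α β γ n *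
      ellHypTerm L w (upperParams w α β n) (lowerParams w α β n) (Complex.exp (-γ * w)) s) := by
  induction s with
  | zero =>
    rw [lbpCoeff_zero_eq L γ hw0 hw (fun k ↦ mod_cast hα k) (by simpa using hb n le_rfl)]
    simp [ellHypTerm_params, ellPoch_zero]
  | succ s ih =>
    have h1 := hα ((s + 1 : ℤ) - n)
    push_cast at h1
    rw [lbpCoeff_succ L γ hs hw h1 (hb s (by lia)), ih (by lia),
      ellHypTerm_succ L _ _ _ _ _ hw0 (by simpa using hw 1 one_ne_zero)]
    ring

/-! ### Orthogonality and the spacing of the nodes. -/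

lemma sum_lbpCoeff_mul_moment {w α β γ : ℂ} {n : ℕ} (hw : ∀ k : ℤ, k ≠ 0 → sigma L (w * k) ≠ 0)
    (hα : ∀ k : ℤ, sigma L (w * k + α) ≠ 0) {i : ℕ} (hi : i < n) :
    ∑ j ∈ Finset.range (n + 1),
      lbpCoeff L w α β γ n j * moment L w α β γ ((j : ℤ) - i) = 0 := by
  -- The zeros in `wj` of the numerator of `q_j c_{j-i}`: the last factor of `q_j`, the numerator of
  -- the moment, and the product without its factor `i`, cancelled by the moment.
  set B : Multiset ℂ := (β + n * α + w * n) ::ₘ (w * i - α - β) ::ₘ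
    ((Finset.range n).erase i).val.map fun m : ℕ ↦ w * m - α with hB
  have hmem : i ∈ Finset.range n := Finset.mem_range.mpr hi
  have key := sum_sigmaFracTerm L (Finset.range (n + 1)) (a := fun k : ℕ ↦ w * k) ?_ B ?_ ?_
  · have h : ∀ j ∈ Finset.range (n + 1),
        lbpCoeff L w α β γ n j * moment L w α β γ ((j : ℤ) - i) =
        -(Complex.exp (-γ * w * i + γ * α) / sigma L β) *
          sigmaFracTerm L (Finset.range (n + 1)) (fun k : ℕ ↦ w * k) B j := by
      intro j hj
      have h1 : Complex.exp (-γ * w * i + γ * α) = Complex.exp (-γ * w * j) *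
          Complex.exp (γ * w * ((j : ℤ) - (i : ℤ) : ℤ) + γ * α) := by
        rw [← Complex.exp_add]; push_cast; ring_nf
      have h2 := hα ((j : ℤ) - i)
      have h3 : (B.map fun b ↦ sigma L (w * j - b)).prod =
          -sigma L (β + n * α + w * (n - j)) *
            (sigma L (w * ((j : ℤ) - (i : ℤ) : ℤ) + β + α) *
              ∏ m ∈ (Finset.range n).erase i, sigma L (α + w * (j - m))) := by
        rw [hB, Multiset.map_cons, Multiset.map_cons, Multiset.prod_cons, Multiset.prod_cons,
          Multiset.map_map, ← sigma_neg]
        congr 1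
        · congr 1; ring
        · congr 1
          · congr 1; push_cast; ring
          · refine Finset.prod_congr rfl fun m _ ↦ ?_
            simp only [Function.comp]
            congr 1; ring
      rw [lbpCoeff, moment, sigmaFracTerm, h1, h3,
        ← Finset.mul_prod_erase _ (fun m : ℕ ↦ sigma L (α + w * (j - m))) hmem]
      rw [show α + w * ((j : ℂ) - i) = w * ((j : ℤ) - (i : ℤ) : ℤ) + α by push_cast; ring]
      generalize ∏ k ∈ (Finset.range (n + 1)).erase j, sigma L (w * j - w * k) = D
      field_simp
    rw [Finset.sum_congr rfl h, ← Finset.mul_sum, key, mul_zero]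
  · intro k _ j _ hkj
    have := hw ((k : ℤ) - j) (by lia)
    push_cast at this
    rwa [mul_sub] at this
  · rw [hB, Multiset.card_cons, Multiset.card_cons, Multiset.card_map, Finset.card_val,
      Finset.card_erase_of_mem hmem, Finset.card_range, Finset.card_range]
    lia
  · have h1 := Finset.add_sum_erase (Finset.range n) (fun m : ℕ ↦ w * m - α) hmem
    have h2 : ∑ m ∈ Finset.range n, (w * m - α) = ∑ m ∈ Finset.range n, w * (m : ℂ) - n * α := by
      simp
    rw [h2] at h1
    rw [hB, Multiset.sum_cons, Multiset.sum_cons, Finset.sum_range_succ]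
    change _ + (_ + ∑ m ∈ (Finset.range n).erase i, (w * m - α)) = _
    linear_combination h1

lemma mul_intCast_notMem_lattice (hω₁ : L.ω₁.im = 0) (hω₂ : L.ω₂.re = 0) {w : ℝ}
    (hw : ∀ N₁ N₂ : ℤ, (N₁ ≠ 0 ∨ N₂ ≠ 0) → (w : ℂ) * N₁ ≠ L.ω₁ / 2 * N₂) {k : ℤ} (hk : k ≠ 0) :
    (w : ℂ) * k ∉ L.lattice := by
  intro h
  obtain ⟨m, l, h⟩ := PeriodPair.mem_lattice.mp h
  have hω₂0 : L.ω₂ ≠ 0 := by simpa using L.indep.ne_zero 1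
  have him : L.ω₂.im ≠ 0 := fun h0 ↦ hω₂0 (Complex.ext hω₂ h0)
  -- `wk` is real and the second period imaginary, so only a multiple of `L.ω₁` remains; `L.ω₁` is
  -- the full period, hence `N₂ = 2m`.
  have h1 := congrArg Complex.im h
  simp [hω₁, him] at h1
  refine hw k (2 * m) (.inl hk) ?_
  rw [← h, h1]
  push_cast
  ring

end EllipticLBP

end

/-! ### Assembly. -/

theorem proposition1 (L : PeriodPair) (hω₁ : L.ω₁.im = 0) (hω₂ : L.ω₂.re = 0)
    (w : ℝ)
    (hw : ∀ N₁ N₂ : ℤ, (N₁ ≠ 0 ∨ N₂ ≠ 0) → (w : ℂ) * N₁ ≠ L.ω₁ / 2 * N₂)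
    (α β γ : ℂ)
    (hα : ∀ k : ℤ, (w : ℂ) * k + α ∉ L.lattice)
    (hβ : β ∉ L.lattice)
    (n : ℕ)
    (hΔ : EllipticLBP.toeplitzDet (EllipticLBP.moment L w α β γ) n ≠ 0)
    (hb : ∀ j : ℕ, j < n → (α + w) * n + β - w * j ∉ L.lattice) :
    (EllipticLBP.lbp (EllipticLBP.moment L w α β γ) n).Monic ∧
    (EllipticLBP.lbp (EllipticLBP.moment L w α β γ) n).natDegree = n ∧
    ∀ z : ℂ,
      (∀ s : ℕ, n < s →
        EllipticLBP.ellHypTerm L w (EllipticLBP.upperParams w α β n)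
          (EllipticLBP.lowerParams w α β n) (z * Complex.exp (-γ * w)) s = 0) ∧
      (EllipticLBP.lbp (EllipticLBP.moment L w α β γ) n).eval z =
        EllipticLBP.coeffB L w α β γ n *
          EllipticLBP.ellHyp L w (EllipticLBP.upperParams w α β n)
            (EllipticLBP.lowerParams w α β n) (z * Complex.exp (-γ * w)) := by
  open EllipticLBP in
  have hwk (k : ℤ) (hk : k ≠ 0) : sigma L (w * k) ≠ 0 :=
    sigma_ne_zero L (mul_intCast_notMem_lattice L hω₁ hω₂ hw hk)
  have hw0 : (w : ℂ) ≠ 0 := by simpa using hw 1 0 (by simp)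
  have hαk (k : ℤ) : sigma L (w * k + α) ≠ 0 := sigma_ne_zero L (hα k)
  have hbs (s : ℕ) (hs : s < n) : sigma L (β + n * α + w * (n - s)) ≠ 0 := by
    convert! sigma_ne_zero L (hb s hs) using 2
    ring
  have horth (i : ℕ) (hi : i < n) := sum_lbpCoeff_mul_moment L (β := β) (γ := γ) hwk hαk hi
  have hdisj (s : ℕ) : ∏ j ∈ (Finset.range (n + 1)).erase s, sigma L (w * s - w * j) ≠ 0 := by
    refine Finset.prod_ne_zero_iff.mpr fun j hj ↦ ?_
    have := hwk ((s : ℤ) - j) (by have := Finset.ne_of_mem_erase hj; lia)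
    push_cast at this
    rwa [mul_sub] at this
  have hq0 : lbpCoeff L w α β γ n 0 ≠ 0 := by
    refine div_ne_zero (mul_ne_zero (mul_ne_zero (Complex.exp_ne_zero _) ?_) ?_) (hdisj 0)
    · refine Finset.prod_ne_zero_iff.mpr fun i _ ↦ ?_
      have := hαk (-i)
      rw [add_comm] at this
      simpa using this
    -- For `n = 0` the remaining factor is `σ(β)`.
    · rcases Nat.eq_zero_or_pos n with rfl | hn
      · simpa using sigma_ne_zero L hβ
      · exact hbs 0 hn
  obtain ⟨hqn, hP⟩ := lbp_eq_of_sum_eq_zero hΔ horth hq0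
  -- The case `s = n`, which gives the denominator `[α̂n+β̂]` of `B_n`, follows from `q_n ≠ 0`,
  -- hence ultimately from `Δ_n ≠ 0`.
  have hbn (s : ℕ) (hs : s ≤ n) : sigma L (β + n * α + w * (n - s)) ≠ 0 := by
    rcases hs.lt_or_eq with hs | rfl
    · exact hbs s hs
    · exact fun h ↦ hqn (by simp only [lbpCoeff, h, mul_zero, zero_div])
  have hcoeff (s : ℕ) (hs : s ≤ n) := lbpCoeff_eq_mul_ellHypTerm L γ hw0
    (fun k hk ↦ by simpa using hwk k (mod_cast hk)) (fun k ↦ by rw [add_comm]; exact hαk k) hbn hs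
  have hmonic : (lbp (moment L w α β γ) n).Monic ∧
      (lbp (moment L w α β γ) n).natDegree = n := by
    have h : lbp (moment L w α β γ) n = X ^ n +
        ∑ j ∈ Finset.range n, C ((lbpCoeff L w α β γ n n)⁻¹ * lbpCoeff L w α β γ n j) * X ^ j := by
      rw [hP, Finset.sum_range_succ, mul_add, ← mul_assoc, ← C_mul, inv_mul_cancel₀ hqn, C_1,
        one_mul, add_comm, Finset.mul_sum]
      simp only [← mul_assoc, ← C_mul]
    have hdeg : (∑ j ∈ Finset.range n,
        C ((lbpCoeff L w α β γ n n)⁻¹ * lbpCoeff L w α β γ n j) * X ^ j).degree < (n : WithBot ℕ) := by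
      rw [← Fin.sum_univ_eq_sum_range fun j ↦
        C ((lbpCoeff L w α β γ n n)⁻¹ * lbpCoeff L w α β γ n j) * X ^ j]
      exact degree_sum_fin_lt _
    rw [h]
    exact ⟨monic_X_pow_add hdeg, by
      rw [natDegree_add_eq_left_of_degree_lt (by rwa [degree_X_pow]), natDegree_X_pow]⟩
  refine ⟨hmonic.1, hmonic.2, fun z ↦ ⟨fun s hs ↦ ellHypTerm_eq_zero L _ _ _ _ hs, ?_⟩⟩
  rw [ellHyp, tsum_eq_sum (s := Finset.range (n + 1)) fun s hs ↦
    ellHypTerm_eq_zero L _ _ _ _ (by simpa using hs), hP, eval_mul, eval_C, eval_finsetSum,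
    Finset.mul_sum, Finset.mul_sum]
  refine Finset.sum_congr rfl fun s hs ↦ ?_
  rw [eval_mul, eval_C, eval_pow, eval_X, ellHypTerm_mul,
    hcoeff s (Nat.lt_succ_iff.mp (Finset.mem_range.mp hs)), mul_assoc, inv_mul_cancel_left₀ hqn]
  ring
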